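/- Let $J\in\mathbb C^{n\times n}$ be a Jordan matrix, that is, a block diagonal matrix $J=\operatorname{diag}(J^1,\dots,J^K)$ whose blocks are Jordan blocks $J^i=\lambda_i I+H$ of orders $k_i\ge 1$ with $k_1+\cdots+k_K=n$ ($H$ has ones on the first superdiagonal and zeros elsewhere; the $\lambda_i\in\mathbb C$ need not be distinct). Let $\lambda_1,\dots,\lambda_p$ now denote the distinct eigenvalues of $J$, let $N_a$ be the number of Jordan blocks with eigenvalue $\lambda_a$, let $k_{a1}\ge k_{a2}\ge\cdots\ge k_{aN_a}$ be the orders of these blocks, put $k_{aj}=0$ for $j>N_a$, and let $N^*=\max_a N_a$ (with $N^*=0$ if $n=0$). For $A\in\mathbb C^{n\times n}$ and $0\le r\le n$ let $D_r$ be the monic greatest common divisor of all minors of order $r$ of $xI-A$ (so $D_0=1$); the $j$-th invariant polynomial of $A$ is $D_{n-j+1}/D_{n-j}$ for $1\le j\le n$, and $1$ for $j>n$. Let $m_j$ be the degree of the $j$-th invariant polynomial of $J$. Then the similarity class $\{A\in\mathbb C^{n\times n} : A=TJT^{-1}\text{ for some invertible }T\in\mathbb C^{n\times n}\}$, i.e.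 the set of matrices with Jordan form $J$, is an embedded complex submanifold of $\mathbb C^{n\times n}$ of complex dimension $$ n^2-\sum_{j=1}^{N^*}(2j-1)\sum_{a=1}^{p}k_{aj}\;=\;n^2-\sum_{j=1}^{N^*}(2j-1)\,m_j .$$ Moreover, for every $j\ge 1$ and every $A$ similar to $J$, the degree of the $j$-th invariant polynomial of $A$ equals $\sum_{a=1}^p k_{aj}$; in particular $m_j=\sum_{a=1}^p k_{aj}$. -/

import Mathlib

open scoped Polynomial

noncomputable section

/-- The Jordan block `c I + H` of order `m`: the scalar `c` on the diagonal, ones on the first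
superdiagonal, zeros elsewhere. -/
def jordanBlock (m : ℕ) (c : ℂ) : Matrix (Fin m) (Fin m) ℂ :=
  Matrix.of fun s t => if s = t then c else if (s : ℕ) + 1 = (t : ℕ) then 1 else 0

/-- The Jordan matrix of order `n` whose diagonal blocks are, in this order, the Jordan blocks of
order `k i` with eigenvalue `lam i`. Eigenvalues may be repeated, in any order. -/
def jordanMatrix {K n : ℕ} (lam : Fin K → ℂ) (k : Fin K → ℕ) (hn : ∑ i, k i = n) :
    Matrix (Fin n) (Fin n) ℂ :=
  Matrix.reindex (finSigmaFinEquiv.trans (finCongr hn)) (finSigmaFinEquiv.trans (finCongr hn))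
    (Matrix.blockDiagonal' fun i => jordanBlock (k i) (lam i))

/-- The set of all `T J T⁻¹` with `T` invertible. -/
def similarityClass {n : ℕ} (J : Matrix (Fin n) (Fin n) ℂ) : Set (Matrix (Fin n) (Fin n) ℂ) :=
  {A | ∃ T : Matrix (Fin n) (Fin n) ℂ, IsUnit T ∧ A = T * J * T⁻¹}

/-- The finite set of distinct eigenvalues of the Jordan matrix. -/
def distinctEigenvalues {K : ℕ} (lam : Fin K → ℂ) : Finset ℂ :=
  Finset.univ.image lam

/-- The number of Jordan blocks with eigenvalue `a`. -/
def numBlocks {K : ℕ} (lam : Fin K → ℂ) (a : ℂ) : ℕ :=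
  (Finset.univ.filter fun i => lam i = a).card

/-- The largest number of Jordan blocks with a common eigenvalue. -/
def maxNumBlocks {K : ℕ} (lam : Fin K → ℂ) : ℕ :=
  (distinctEigenvalues lam).sup (numBlocks lam)

/-- The orders of the Jordan blocks with eigenvalue `a`, in decreasing order. -/
def blockOrders {K : ℕ} (lam : Fin K → ℂ) (k : Fin K → ℕ) (a : ℂ) : List ℕ :=
  ((Finset.univ.filter fun i => lam i = a).val.map k).sort (· ≥ ·)

/-- The order of the `j`-th largest Jordan block with eigenvalue `a`, for `j = 1, 2, …`;
it is `0` if there are fewer than `j` such blocks. -/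
def blockOrder {K : ℕ} (lam : Fin K → ℂ) (k : Fin K → ℕ) (a : ℂ) (j : ℕ) : ℕ :=
  (blockOrders lam k a).getD (j - 1) 0

/-- The ideal of `ℂ[X]` generated by all minors of order `r` of the matrix `X I - A`. -/
def minorIdeal {n : ℕ} (A : Matrix (Fin n) (Fin n) ℂ) (r : ℕ) : Ideal ℂ[X] :=
  Ideal.span (Set.range fun f : (Fin r ↪o Fin n) × (Fin r ↪o Fin n) =>
    (A.charmatrix.submatrix f.1 f.2).det)

/-- The monic greatest common divisor `D_r` of all minors of order `r` of `X I - A`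
(`D_0 = 1`). -/
def determinantalDivisor {n : ℕ} (A : Matrix (Fin n) (Fin n) ℂ) (r : ℕ) : ℂ[X] :=
  normalize (Submodule.IsPrincipal.generator (minorIdeal A r))

/-- The `j`-th invariant polynomial of `A`, `j = 1, 2, …, n`, in the order in which each one is
divisible by the next one: `D_n / D_{n-1}`, `D_{n-1} / D_{n-2}`, …, `D_1 / D_0`.
For `j > n` this is `D_0 / D_0 = 1`. -/
def invariantPolynomial {n : ℕ} (A : Matrix (Fin n) (Fin n) ℂ) (j : ℕ) : ℂ[X] :=
  determinantalDivisor A (n + 1 - j) / determinantalDivisor A (n - j)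

/-- `S` is a nonempty (embedded) complex submanifold of complex dimension `d` of the space of
complex matrices of order `n`: around each of its points there are local holomorphic coordinates
(a biholomorphic map `φ` between open sets) in which `S` becomes a linear subspace of complex
dimension `d`. -/
def HasComplexDim {n : ℕ} (S : Set (Matrix (Fin n) (Fin n) ℂ)) (d : ℕ) : Prop :=
  S.Nonempty ∧ ∀ x ∈ S,
    ∃ (φ : OpenPartialHomeomorph (Matrix (Fin n) (Fin n) ℂ) (Matrix (Fin n) (Fin n) ℂ))
      (L : Submodule ℂ (Matrix (Fin n) (Fin n) ℂ)),
      x ∈ φ.source ∧ DifferentiableOn ℂ φ φ.source ∧ DifferentiableOn ℂ φ.symm φ.target ∧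
      Module.finrank ℂ L = d ∧ ∀ y ∈ φ.source, y ∈ S ↔ φ y ∈ L

end

/-!
The proof has two independent halves: the similarity class of `J` is a submanifold whose codimension
is the dimension of the centralizer of `J`, and both this dimension and the degrees of the
invariant polynomials are read off from the block structure.

*Submanifold.* Write `ad x` for `v ↦ v x - x v`, let `s` be a generalized inverse of it and
`q = 1 - ad x ∘ s`. The map `m ↦ (1 + s m) (x + q m) (1 + s m)⁻¹` has derivative `1` at `0`, so by
the inverse function theorem it is a holomorphic coordinate system at `x`. It carries small elements
of the range of `ad x` into the orbit of `x`. That it yields all of the orbit near `x`, so that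
the orbit is embedded and not only immersed, is the content of `exists_small_intertwiner`: for `y`
in the orbit, the space of solutions of `v x = y v` has the same dimension as the centralizer of
`x`, hence for `y` near `x` it contains an element near `1`.

*Centralizer.* A matrix commutes with `J` if and only if its blocks intertwine the Jordan blocks. For
different eigenvalues such a block vanishes; for equal eigenvalues it is a Toeplitz matrix with
`min k l` free parameters (`finrank_matrixIntertwiners_jordanBlock`). For a decreasing list, the sum
of the minima of all pairs of entries counts the `j`-th entry `2 j - 1` times (`List.sum_sum_min`).

*Invariant polynomials.* The ideal of minors of order `r` does not change under multiplication by
invertible matrices, hence is the same for similar matrices; and it may be computed from the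
diagonal matrix with one entry `(X - c) ^ k` for each block, all others being `1`. There the multiplicity
of `a` in `D_r` is the least exponent of `X - a` in a product of `r` diagonal entries, that is, the sum
of the orders of all blocks with eigenvalue `a` but the `n - r` largest ones
(`natDegree_generator_minorIdeal_jordanMatrix`). Passing from `D_{n-j}` to `D_{n-j+1}` adds the
`j`-th largest order for each eigenvalue.
-/

/-! ### Similarity orbits are submanifolds -/

theorem LinearMap.exists_generalized_inverse {F V W : Type*} [Field F]
    [AddCommGroup V] [Module F V] [AddCommGroup W] [Module F W] (f : V →ₗ[F] W) :
    ∃ s : W →ₗ[F] V, ∀ v, f (s (f v)) = f v := by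
  obtain ⟨g, hg⟩ := f.rangeRestrict.exists_rightInverse_of_surjective f.range_rangeRestrict
  obtain ⟨p, hp⟩ := (LinearMap.range f).subtype.exists_leftInverse_of_injective
    (Submodule.ker_subtype _)
  have hg' (y : LinearMap.range f) : f (g y) = y :=
    congrArg Subtype.val (LinearMap.congr_fun hg y)
  have hp' (y : LinearMap.range f) : p y = y := LinearMap.congr_fun hp y
  refine ⟨g ∘ₗ p, fun v => ?_⟩
  simp only [LinearMap.comp_apply, hg']
  exact congrArg Subtype.val (hp' ⟨f v, v, rfl⟩)

section Orbit

variable {E : Type*} [NormedRing E] [NormedAlgebra ℂ E]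

/-- The linear map `v ↦ v x - y v`, whose kernel is the space of intertwiners from `x` to `y`. -/
noncomputable def intertwine (x y : E) : E →ₗ[ℂ] E := LinearMap.mulRight ℂ x - LinearMap.mulLeft ℂ y

@[simp] theorem intertwine_apply (x y v : E) : intertwine x y v = v * x - y * v := rfl

/-- Conjugating the target does not enlarge the rank: `intertwine x (u x u⁻¹)` is
`intertwine x x` composed with multiplications by `u` and `u⁻¹`. -/
theorem finrank_range_intertwine_conj_le [FiniteDimensional ℂ E] (x : E) (u : Eˣ) :
    Module.finrank ℂ (LinearMap.range (intertwine x (↑u * x * ↑u⁻¹))) ≤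
      Module.finrank ℂ (LinearMap.range (intertwine x x)) := by
  have h : LinearMap.range (intertwine x (↑u * x * ↑u⁻¹)) ≤
      (LinearMap.range (intertwine x x)).map (LinearMap.mulLeft ℂ (u : E)) := by
    rintro _ ⟨v, rfl⟩
    refine ⟨intertwine x x (↑u⁻¹ * v), ⟨_, rfl⟩, ?_⟩
    simp [mul_sub, mul_assoc]
  exact (Submodule.finrank_mono h).trans (Submodule.finrank_map_le _ _)

theorem finrank_range_intertwine_conj_conj_le [FiniteDimensional ℂ E] (x : E) (u : Eˣ) :
    Module.finrank ℂ (LinearMap.range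
        (intertwine (↑u * x * ↑u⁻¹) ((↑u : E) * x * ↑u⁻¹))) ≤
      Module.finrank ℂ (LinearMap.range (intertwine x x)) := by
  have h : LinearMap.range (intertwine (↑u * x * ↑u⁻¹) ((↑u : E) * x * ↑u⁻¹)) ≤
      ((LinearMap.range (intertwine x x)).map (LinearMap.mulLeft ℂ (u : E))).map
        (LinearMap.mulRight ℂ (↑u⁻¹ : E)) := by
    rintro _ ⟨v, rfl⟩
    refine ⟨_, ⟨intertwine x x (↑u⁻¹ * v * u), ⟨_, rfl⟩, rfl⟩, ?_⟩
    simp [mul_sub, sub_mul, mul_assoc]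
  exact (Submodule.finrank_mono h).trans ((Submodule.finrank_map_le _ _).trans
    (Submodule.finrank_map_le _ _))

/-- The rank of `ad x` is constant on the similarity orbit of `x`. -/
theorem finrank_range_intertwine_conj [FiniteDimensional ℂ E] (x : E) (u : Eˣ) :
    Module.finrank ℂ (LinearMap.range
        (intertwine (↑u * x * ↑u⁻¹) ((↑u : E) * x * ↑u⁻¹))) =
      Module.finrank ℂ (LinearMap.range (intertwine x x)) := by
  refine le_antisymm (finrank_range_intertwine_conj_conj_le x u) ?_
  have h := finrank_range_intertwine_conj_conj_le (↑u * x * ↑u⁻¹) u⁻¹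
  have e : (↑u⁻¹ * (↑u * x * ↑u⁻¹) * ↑(u⁻¹)⁻¹ : E) = x := by simp [mul_assoc]
  rwa [e] at h

/-- Near `x`, every element `y` of the orbit of `x` is conjugate to `x` by some `1 + s m`, where `m`
lies in the range `R` of `ad x` and is close to `0`. For `y` near `x` the map `v ↦ v x - y v` is
bounded below on `s R`, and for `y` in the orbit its rank does not exceed `dim R`; so it maps `s R`
onto its whole range, and `x - y`, the image of `1`, is the image of a small element of `s R`. -/
theorem exists_small_intertwiner [FiniteDimensional ℂ E] (x : E) (s : E →L[ℂ] E)
    (hs : ∀ v, intertwine x x (s (intertwine x x v)) = intertwine x x v)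
    {ε : ℝ} (hε : 0 < ε) :
    ∀ᶠ y in nhds x, (∃ u : Eˣ, y = u * x * ↑u⁻¹) →
      ∃ m ∈ LinearMap.range (intertwine x x), ‖m‖ < ε ∧ (1 + s m) * x = y * (1 + s m) := by
  have hc : 0 < 2 * (‖s‖ + 1) := by positivity
  have hδ : 0 < min (1 / (2 * (‖s‖ + 1))) (ε / 2) := by positivity
  filter_upwards [Metric.ball_mem_nhds x hδ] with y hy ⟨u, hu⟩
  rw [mem_ball_iff_norm, lt_min_iff, lt_div_iff₀ hc] at hy
  obtain ⟨hy1, hy2⟩ := hy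
  set R := LinearMap.range (intertwine x x) with hR
  have hsR (m : E) (hm : m ∈ R) : s m * x - x * s m = m := by
    obtain ⟨v, rfl⟩ := hm
    exact hs v
  have key (m : E) (hm : m ∈ R) : ‖m‖ ≤ 2 * ‖intertwine x y (s m)‖ := by
    have e : m = intertwine x y (s m) + (y - x) * s m := by
      rw [intertwine_apply, sub_mul]
      nth_rewrite 1 [← hsR m hm]
      abel
    have h1 : ‖m‖ ≤ ‖intertwine x y (s m)‖ + ‖(y - x) * s m‖ := by
      nth_rewrite 1 [e]
      exact norm_add_le _ _
    have h2 : ‖(y - x) * s m‖ ≤ ‖y - x‖ * (‖s‖ * ‖m‖) :=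
      (norm_mul_le _ _).trans (mul_le_mul_of_nonneg_left (s.le_opNorm m) (norm_nonneg _))
    have h3 : ‖y - x‖ * ‖s‖ * ‖m‖ ≤ 1 / 2 * ‖m‖ := by
      refine mul_le_mul_of_nonneg_right ?_ (norm_nonneg _)
      nlinarith [norm_nonneg (y - x)]
    linarith [mul_assoc ‖y - x‖ ‖s‖ ‖m‖]
  let f : R →ₗ[ℂ] E := intertwine x y ∘ₗ s.toLinearMap ∘ₗ R.subtype
  have hf : Function.Injective f := by
    rw [← LinearMap.ker_eq_bot, LinearMap.ker_eq_bot']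
    intro m hm
    have h1 := key m m.2
    have h2 : intertwine x y (s m) = 0 := hm
    rw [h2, norm_zero, mul_zero] at h1
    exact Subtype.ext (norm_le_zero_iff.mp h1)
  have hle : LinearMap.range f ≤ LinearMap.range (intertwine x y) := LinearMap.range_comp_le_range _ _
  have heq : LinearMap.range f = LinearMap.range (intertwine x y) := by
    refine Submodule.eq_of_le_of_finrank_le hle ?_
    rw [LinearMap.finrank_range_of_inj hf, hu]
    exact finrank_range_intertwine_conj_le x u
  obtain ⟨m, hm⟩ : intertwine x y 1 ∈ LinearMap.range f := heq ▸ ⟨1, rfl⟩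
  have hm' : intertwine x y (s m) = x - y := by
    have h : intertwine x y (s m) = intertwine x y 1 := hm
    simpa using h
  refine ⟨-m, R.neg_mem m.2, ?_, ?_⟩
  · have h1 := key m m.2
    rw [hm', norm_sub_rev] at h1
    rw [norm_neg]
    linarith
  · rw [intertwine_apply] at hm'
    rw [map_neg, add_mul, mul_add, neg_mul, mul_neg, one_mul, mul_one]
    rw [sub_eq_sub_iff_add_eq_add] at hm'
    rw [← sub_eq_add_neg, ← sub_eq_add_neg, sub_eq_sub_iff_add_eq_add, ← hm', add_comm]

/-- Around `x`, the orbit of `x` under conjugation is carried by a holomorphic chart to the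
range of `ad x`. The chart inverts `m ↦ (1 + s m) (x + q m) (1 + s m)⁻¹`, where `s` is a
generalized inverse of `ad x` and `q = 1 - ad x ∘ s`; the derivative of this map at `0` is the
identity. -/
theorem exists_orbit_chart [FiniteDimensional ℂ E] (x : E) :
    ∃ φ : OpenPartialHomeomorph E E, x ∈ φ.source ∧ DifferentiableOn ℂ φ φ.source ∧
      DifferentiableOn ℂ φ.symm φ.target ∧
      ∀ y ∈ φ.source, (∃ u : Eˣ, y = u * x * ↑u⁻¹) ↔ φ y ∈ LinearMap.range (intertwine x x) := by
  have : CompleteSpace E := FiniteDimensional.complete ℂ E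
  obtain ⟨s₀, hs₀⟩ := (intertwine x x).exists_generalized_inverse
  let s : E →L[ℂ] E := LinearMap.toContinuousLinearMap s₀
  have hs (v : E) : intertwine x x (s (intertwine x x v)) = intertwine x x v := hs₀ v
  let q : E →L[ℂ] E :=
    ContinuousLinearMap.id ℂ E - LinearMap.toContinuousLinearMap (intertwine x x ∘ₗ s₀)
  have hq (m : E) : q m = m - (s m * x - x * s m) := rfl
  have hqR (m : E) (hm : m ∈ LinearMap.range (intertwine x x)) : q m = 0 := by
    obtain ⟨v, rfl⟩ := hm
    rw [hq, sub_eq_zero]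
    exact (hs v).symm
  let Ψ : E → E := fun m => (1 + s m) * (x + q m) * Ring.inverse (1 + s m)
  have hΨ0 : Ψ 0 = x := by simp [Ψ]
  have hunit0 : (1 : E) + s 0 = ((1 : Eˣ) : E) := by simp
  have hinv (m : E) (hm : IsUnit (1 + s m)) :
      ContDiffAt ℂ 1 (fun m => Ring.inverse (1 + s m)) m := by
    obtain ⟨u, hu⟩ := hm
    refine ContDiffAt.comp m (g := Ring.inverse) ?_ (by fun_prop)
    rw [← hu]
    exact contDiffAt_ringInverse ℂ u
  have hΨsm (m : E) (hm : IsUnit (1 + s m)) : ContDiffAt ℂ 1 Ψ m :=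
    ContDiffAt.mul (ContDiffAt.mul (by fun_prop) (by fun_prop)) (hinv m hm)
  have hU0 : IsUnit ((1 : E) + s 0) := hunit0 ▸ Units.isUnit _
  have hder : HasFDerivAt Ψ ((ContinuousLinearEquiv.refl ℂ E : E ≃L[ℂ] E) : E →L[ℂ] E) 0 := by
    have h1 : HasFDerivAt (fun m => 1 + s m) s 0 := s.hasFDerivAt.const_add 1
    have h2 : HasFDerivAt (fun m => x + q m) q 0 := q.hasFDerivAt.const_add x
    have h3 : HasFDerivAt (fun m => Ring.inverse (1 + s m)) (-s) 0 := by
      have h := hasFDerivAt_ringInverse (𝕜 := ℂ) (1 : Eˣ)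
      rw [← hunit0] at h
      convert! h.comp (0 : E) h1 using 1
      ext m
      simp
    refine ((h1.mul' h2).mul' h3).congr_fderiv ?_
    ext m
    simp [hq]
    abel
  let Φ := (hΨsm 0 hU0).toOpenPartialHomeomorph Ψ hder one_ne_zero
  have hΦ : (Φ : E → E) = Ψ := rfl
  have h0 : (0 : E) ∈ Φ.source :=
    (hΨsm 0 hU0).mem_toOpenPartialHomeomorph_source hder one_ne_zero
  have hxt : x ∈ Φ.target := by
    have := Φ.map_source h0
    rwa [hΦ, hΨ0] at this
  have hsx : Φ.symm x = 0 := by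
    have := Φ.left_inv h0
    rwa [hΦ, hΨ0] at this
  have hsymm : ContDiffAt ℂ 1 Φ.symm x := by
    refine Φ.contDiffAt_symm (f₀' := ContinuousLinearEquiv.refl ℂ E) hxt ?_ ?_
    · rw [hsx]; exact hder
    · rw [hsx]; exact hΨsm 0 hU0
  -- an open neighbourhood of `0` on which `1 + s m` is invertible
  let A : Set E := {m | IsUnit (1 + s m)}
  have hA : IsOpen A := Units.isOpen.preimage (by fun_prop : Continuous fun m => 1 + s m)
  obtain ⟨ε, hε, hball⟩ := Metric.mem_nhds_iff.mp
    ((Φ.open_source.inter hA).mem_nhds ⟨h0, hU0⟩)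
  have hev := (hsymm.eventually (by simp)).and (exists_small_intertwiner x s hs hε)
  obtain ⟨B, hBsub, hB, hxB⟩ := mem_nhds_iff.mp hev
  have hA' := Φ.isOpen_inter_preimage hA
  let φ := (Φ.restrOpen A hA).symm.restrOpen B hB
  have hsrc : φ.source ⊆ B := fun y hy => hy.2
  refine ⟨φ, ⟨?_, hxB⟩, ?_, ?_, ?_⟩
  · have := (Φ.restrOpen A hA).map_source (x := 0) ⟨h0, hU0⟩
    change Ψ 0 ∈ _ at this
    rwa [hΨ0] at this
  · intro y hy
    exact ((hBsub (hsrc hy)).1.differentiableAt one_ne_zero).differentiableWithinAt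
  · intro m hm
    have hmA : m ∈ A := hm.1.2
    exact ((hΨsm m hmA).differentiableAt one_ne_zero).differentiableWithinAt
  · intro y hy
    have hyt : y ∈ (Φ.restrOpen A hA).target := hy.1
    constructor
    · intro hyo
      obtain ⟨m, hmR, hmε, hm⟩ := (hBsub (hsrc hy)).2 hyo
      obtain ⟨hmS, hmA⟩ := hball (mem_ball_zero_iff.mpr hmε)
      have hy' : Φ m = y := by
        change (1 + s m) * (x + q m) * Ring.inverse (1 + s m) = y
        rw [hqR m hmR, add_zero, hm, Ring.mul_inverse_cancel_right _ _ hmA]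
      change Φ.symm y ∈ _
      rwa [← hy', Φ.left_inv hmS]
    · intro hyR
      change Φ.symm y ∈ _ at hyR
      have hmA : Φ.symm y ∈ A := ((Φ.restrOpen A hA).map_target hyt).2
      have hy' : Ψ (Φ.symm y) = y := Φ.right_inv hyt.1
      obtain ⟨u, hu⟩ := hmA
      refine ⟨u, ?_⟩
      rw [← hy']
      change (1 + s _) * (x + q _) * Ring.inverse (1 + s _) = _
      rw [hqR _ hyR, add_zero, ← hu, Ring.inverse_unit]

end Orbit

section Matrix

attribute [local instance] Matrix.linftyOpNormedRing Matrix.linftyOpNormedAlgebra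

theorem mem_similarityClass_iff {n : ℕ} {J A : Matrix (Fin n) (Fin n) ℂ} :
    A ∈ similarityClass J ↔ ∃ u : (Matrix (Fin n) (Fin n) ℂ)ˣ,
      A = (u : Matrix (Fin n) (Fin n) ℂ) * J * (u⁻¹ : (Matrix (Fin n) (Fin n) ℂ)ˣ) := by
  constructor
  · rintro ⟨_, ⟨u, rfl⟩, h⟩
    exact ⟨u, by rw [h, Matrix.coe_units_inv]⟩
  · rintro ⟨u, h⟩
    exact ⟨u, u.isUnit, by rw [h, Matrix.coe_units_inv]⟩

/-- The similarity class of `J` is a complex submanifold whose dimension is the rank of `ad J`. -/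
theorem hasComplexDim_similarityClass {n : ℕ} (J : Matrix (Fin n) (Fin n) ℂ) :
    HasComplexDim (similarityClass J)
      (Module.finrank ℂ (LinearMap.range (intertwine J J))) := by
  refine ⟨⟨J, mem_similarityClass_iff.mpr ⟨1, by simp⟩⟩, fun x hx => ?_⟩
  obtain ⟨u, rfl⟩ := mem_similarityClass_iff.mp hx
  obtain ⟨φ, h1, h2, h3, h4⟩ := exists_orbit_chart
    ((u : Matrix (Fin n) (Fin n) ℂ) * J * (u⁻¹ : (Matrix (Fin n) (Fin n) ℂ)ˣ))
  refine ⟨φ, _, h1, h2, h3, finrank_range_intertwine_conj J u, fun y hy => ?_⟩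
  refine mem_similarityClass_iff.trans (Iff.trans ?_ (h4 y hy))
  constructor
  · rintro ⟨v, rfl⟩
    exact ⟨v * u⁻¹, by simp [mul_assoc]⟩
  · rintro ⟨v, rfl⟩
    exact ⟨v * u, by simp [mul_assoc]⟩

end Matrix


/-! ### The dimension of the centralizer of a Jordan matrix -/

/-- The space of rectangular matrices `X` with `X Q = P X`. -/
def matrixIntertwiners {l m : Type*} [Fintype l] [Fintype m] (P : Matrix l l ℂ)
    (Q : Matrix m m ℂ) : Submodule ℂ (Matrix l m ℂ) where
  carrier := {X | X * Q = P * X}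
  add_mem' {X Y} hX hY := by
    change (X + Y) * Q = P * (X + Y)
    rw [Matrix.add_mul, Matrix.mul_add, hX, hY]
  zero_mem' := by simp
  smul_mem' c X hX := by
    change (c • X) * Q = P * (c • X)
    rw [Matrix.smul_mul, Matrix.mul_smul, hX]

theorem mem_matrixIntertwiners {l m : Type*} [Fintype l] [Fintype m] {P : Matrix l l ℂ}
    {Q : Matrix m m ℂ} {X : Matrix l m ℂ} : X ∈ matrixIntertwiners P Q ↔ X * Q = P * X :=
  Iff.rfl

section Blocks

variable {ι N : Type*} {m : ι → Type*} [Fintype ι] [DecidableEq ι] [∀ i, Fintype (m i)]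
  [Fintype N]

theorem mul_reindex_blockDiagonal'_apply (e : (Σ i, m i) ≃ N) (B : ∀ i, Matrix (m i) (m i) ℂ)
    (X : Matrix N N ℂ) (a : N) (i : ι) (t : m i) :
    (X * Matrix.reindex e e (Matrix.blockDiagonal' B)) a (e ⟨i, t⟩) =
      ∑ u, X a (e ⟨i, u⟩) * B i u t := by
  rw [Matrix.mul_apply, ← e.sum_comp, Fintype.sum_sigma, Finset.sum_eq_single i]
  · simp
  · intro j _ hj
    simp [Matrix.blockDiagonal'_apply_ne B _ _ hj]
  · simp

theorem reindex_blockDiagonal'_mul_apply (e : (Σ i, m i) ≃ N) (B : ∀ i, Matrix (m i) (m i) ℂ)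
    (X : Matrix N N ℂ) (i : ι) (s : m i) (b : N) :
    (Matrix.reindex e e (Matrix.blockDiagonal' B) * X) (e ⟨i, s⟩) b =
      ∑ u, B i s u * X (e ⟨i, u⟩) b := by
  rw [Matrix.mul_apply, ← e.sum_comp, Fintype.sum_sigma, Finset.sum_eq_single i]
  · simp
  · intro j _ hj
    simp [Matrix.blockDiagonal'_apply_ne B _ _ hj.symm]
  · simp

/-- A matrix commutes with a block diagonal matrix if and only if each of its blocks intertwines
the corresponding diagonal blocks. -/
def commutantEquivBlocks (e : (Σ i, m i) ≃ N) (B : ∀ i, Matrix (m i) (m i) ℂ) :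
    matrixIntertwiners (Matrix.reindex e e (Matrix.blockDiagonal' B))
        (Matrix.reindex e e (Matrix.blockDiagonal' B)) ≃ₗ[ℂ]
      ∀ p : ι × ι, matrixIntertwiners (B p.1) (B p.2) where
  toFun X p := ⟨Matrix.of fun s t => X.1 (e ⟨p.1, s⟩) (e ⟨p.2, t⟩), by
    ext s t
    have h := congrFun (congrFun X.2 (e ⟨p.1, s⟩)) (e ⟨p.2, t⟩)
    rw [mul_reindex_blockDiagonal'_apply, reindex_blockDiagonal'_mul_apply] at h
    simpa [Matrix.mul_apply] using h⟩
  map_add' X Y := rfl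
  map_smul' c X := rfl
  invFun Y := ⟨Matrix.reindex e e (Matrix.of fun a b => (Y (a.1, b.1)).1 a.2 b.2), by
    rw [mem_matrixIntertwiners]
    ext a b
    obtain ⟨⟨i, s⟩, rfl⟩ := e.surjective a
    obtain ⟨⟨j, t⟩, rfl⟩ := e.surjective b
    rw [mul_reindex_blockDiagonal'_apply, reindex_blockDiagonal'_mul_apply]
    have h := congrFun (congrFun (Y (i, j)).2 s) t
    simp only [Matrix.mul_apply] at h
    simpa only [Matrix.reindex_apply, Matrix.submatrix_apply, Equiv.symm_apply_apply,
      Matrix.of_apply] using h⟩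
  left_inv X := by
    ext a b
    simp
  right_inv Y := by
    ext p s t
    simp only [Matrix.reindex_apply, Matrix.submatrix_apply, Equiv.symm_apply_apply,
      Matrix.of_apply]

theorem finrank_matrixIntertwiners_blockDiagonal' (e : (Σ i, m i) ≃ N)
    (B : ∀ i, Matrix (m i) (m i) ℂ) :
    Module.finrank ℂ (matrixIntertwiners (Matrix.reindex e e (Matrix.blockDiagonal' B))
        (Matrix.reindex e e (Matrix.blockDiagonal' B))) =
      ∑ i, ∑ j, Module.finrank ℂ (matrixIntertwiners (B i) (B j)) := by
  rw [(commutantEquivBlocks e B).finrank_eq, Module.finrank_pi_fintype, Fintype.sum_prod_type]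

end Blocks

theorem jordanBlock_mul_apply {k l : ℕ} (c : ℂ) (X : Matrix (Fin k) (Fin l) ℂ) (s : Fin k)
    (t : Fin l) : (jordanBlock k c * X) s t =
      c * X s t + if h : (s : ℕ) + 1 < k then X ⟨s + 1, h⟩ t else 0 := by
  have e (u : Fin k) : jordanBlock k c s u * X u t =
      (if s = u then c * X u t else 0) +
        if (s : ℕ) + 1 = u then X u t else 0 := by
    by_cases h : s = u
    · subst h
      simp [jordanBlock]
    · simp [jordanBlock, h]
  rw [Matrix.mul_apply, Finset.sum_congr rfl fun u _ => e u, Finset.sum_add_distrib,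
    Finset.sum_ite_eq, if_pos (Finset.mem_univ s)]
  congr 1
  split_ifs with h
  · rw [Finset.sum_eq_single ⟨s + 1, h⟩]
    · simp
    · intro u _ hu
      exact if_neg fun h' => hu (Fin.ext h'.symm)
    · simp
  · exact Finset.sum_eq_zero fun u _ => if_neg fun h' => h (by omega)

theorem mul_jordanBlock_apply {k l : ℕ} (c : ℂ) (X : Matrix (Fin k) (Fin l) ℂ) (s : Fin k)
    (t : Fin l) : (X * jordanBlock l c) s t =
      c * X s t + if 0 < (t : ℕ) then X s ⟨t - 1, by omega⟩ else 0 := by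
  have e (u : Fin l) : X s u * jordanBlock l c u t =
      (if u = t then c * X s u else 0) +
        if (u : ℕ) + 1 = t then X s u else 0 := by
    by_cases h : u = t
    · subst h
      simp [jordanBlock, mul_comm]
    · simp [jordanBlock, h]
  rw [Matrix.mul_apply, Finset.sum_congr rfl fun u _ => e u, Finset.sum_add_distrib,
    Finset.sum_ite_eq', if_pos (Finset.mem_univ t)]
  congr 1
  split_ifs with h
  · rw [Finset.sum_eq_single ⟨t - 1, by omega⟩]
    · exact if_pos (by simp; omega)
    · intro u _ hu
      exact if_neg fun h' => hu (Fin.ext (by simp; omega))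
    · simp
  · exact Finset.sum_eq_zero fun u _ => if_neg fun h' => h (by omega)

/-- The entries of an intertwiner `X` of two Jordan blocks satisfy a recursion along the
diagonals. -/
theorem mem_matrixIntertwiners_jordanBlock {k l : ℕ} {c d : ℂ} {X : Matrix (Fin k) (Fin l) ℂ} :
    X ∈ matrixIntertwiners (jordanBlock k c) (jordanBlock l d) ↔ ∀ s t,
      d * X s t + (if 0 < (t : ℕ) then X s ⟨t - 1, by omega⟩ else 0) =
        c * X s t + if h : (s : ℕ) + 1 < k then X ⟨s + 1, h⟩ t else 0 := by
  rw [mem_matrixIntertwiners, ← Matrix.ext_iff]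
  simp only [jordanBlock_mul_apply, mul_jordanBlock_apply]

theorem matrixIntertwiners_jordanBlock_of_ne {k l : ℕ} {c d : ℂ} (h : c ≠ d) :
    matrixIntertwiners (jordanBlock k c) (jordanBlock l d) = ⊥ := by
  rw [Submodule.eq_bot_iff]
  intro X hX
  rw [mem_matrixIntertwiners_jordanBlock] at hX
  -- induction from the lower left corner
  have key (r : ℕ) : ∀ (s : Fin k) (t : Fin l), (k - 1 - s) + t = r → X s t = 0 := by
    induction r using Nat.strong_induction_on with
    | _ r ih =>
      intro s t hr
      have h1 : (if 0 < (t : ℕ) then X s ⟨t - 1, by omega⟩ else 0) = 0 := by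
        split_ifs with ht
        · exact ih (r - 1) (by omega) s ⟨t - 1, by omega⟩ (by dsimp only; omega)
        · rfl
      have h2 : (if h : (s : ℕ) + 1 < k then X ⟨s + 1, h⟩ t else 0) = 0 := by
        split_ifs with hs
        · exact ih (r - 1) (by omega) ⟨s + 1, hs⟩ t (by dsimp only; omega)
        · rfl
      have h3 := hX s t
      rw [h1, h2, add_zero, add_zero] at h3
      by_contra h4
      exact h (mul_right_cancel₀ h4 h3).symm
  ext s t
  exact key _ s t rfl

/-- An intertwiner of two Jordan blocks with the same eigenvalue is a Toeplitz matrix, determined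
by the last `min k l` entries of its first row, which are arbitrary. -/
def jordanIntertwinersEquiv (k l : ℕ) (c : ℂ) :
    matrixIntertwiners (jordanBlock k c) (jordanBlock l c) ≃ₗ[ℂ] (Fin (min k l) → ℂ) where
  toFun X j := X.1 ⟨0, by have := j.2; omega⟩ ⟨l - 1 - j, by have := j.2; omega⟩
  map_add' X Y := rfl
  map_smul' c X := rfl
  invFun x := ⟨Matrix.of fun s t =>
      if h : l - 1 + (s : ℕ) - t < min k l then x ⟨l - 1 + s - t, h⟩ else 0, by
    rw [mem_matrixIntertwiners_jordanBlock]
    intro s t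
    congr 1
    simp only [Matrix.of_apply]
    by_cases ht : 0 < (t : ℕ)
    · have e : l - 1 + (s : ℕ) - (t - 1) = l - 1 + (s + 1) - t := by omega
      simp only [ht, if_true, e]
      by_cases hs : (s : ℕ) + 1 < k
      · rw [dif_pos hs]
      · rw [dif_neg hs, dif_neg (by omega)]
    · rw [if_neg ht]
      by_cases hs : (s : ℕ) + 1 < k
      · rw [dif_pos hs, dif_neg (by omega)]
      · rw [dif_neg hs]⟩
  left_inv X := by
    obtain ⟨X, hX⟩ := X
    have hX' (s : Fin k) (t : Fin l) := add_left_cancel (mem_matrixIntertwiners_jordanBlock.mp hX s t)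
    -- going up the diagonal to the first column: zero below the main diagonal
    have hneg (r : ℕ) : ∀ (s : Fin k) (t : Fin l), (t : ℕ) = r → t < (s : ℕ) → X s t = 0 := by
      induction r with
      | zero =>
        intro s t ht hst
        have h := hX' ⟨s - 1, by omega⟩ t
        rw [if_neg (by omega), dif_pos (by dsimp only; omega)] at h
        rw [h]
        congr 1
        exact Fin.ext (by dsimp only; omega)
      | succ r ih =>
        intro s t ht hst
        have h := hX' ⟨s - 1, by omega⟩ t
        rw [if_pos (by omega), dif_pos (by dsimp only; omega),
          ih _ ⟨t - 1, by omega⟩ (by dsimp only; omega) (by dsimp only; omega)] at h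
        rw [h]
        congr 1
        exact Fin.ext (by dsimp only; omega)
    -- going down the diagonal to the last row: zero on the diagonals that leave through it
    have hlow (r : ℕ) : ∀ (s : Fin k) (t : Fin l), k - 1 - s = r →
        k ≤ l - 1 + (s : ℕ) - t → X s t = 0 := by
      induction r with
      | zero =>
        intro s t hs hst
        have h := hX' s ⟨t + 1, by omega⟩
        rw [dif_neg (by omega)] at h
        simpa using h
      | succ r ih =>
        intro s t hs hst
        have h := hX' s ⟨t + 1, by omega⟩
        rw [dif_pos (by omega),
          ih ⟨s + 1, by omega⟩ ⟨t + 1, by omega⟩ (by dsimp only; omega) (by dsimp only; omega)] at h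
        simpa using h
    -- constancy along the remaining diagonals
    have hdiag (r : ℕ) : ∀ (hr : r < k) (t : Fin l), (h : l - 1 + r - t < min k l) →
        X ⟨0, by omega⟩ ⟨l - 1 - (l - 1 + r - t), by omega⟩ = X ⟨r, hr⟩ t := by
      induction r with
      | zero =>
        intro hr t h
        congr 2
        simp
        omega
      | succ r ih =>
        intro hr t h
        have h1 := hX' ⟨r, by omega⟩ t
        rw [dif_pos hr, if_pos (by omega)] at h1
        rw [← h1, ← ih (by omega) _ (by simp; omega)]
        congr 2
        simp
        omega
    ext s t
    simp only [Matrix.of_apply]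
    split_ifs with h
    · exact hdiag s s.2 t h
    · by_cases hst : (t : ℕ) < s
      · exact (hneg _ s t rfl hst).symm
      · exact (hlow _ s t rfl (by omega)).symm
  right_inv x := by
    ext j
    have e : l - 1 + 0 - (l - 1 - (j : ℕ)) = j := by omega
    simp only [Matrix.of_apply, e]
    rw [dif_pos j.2]

theorem finrank_matrixIntertwiners_jordanBlock (k l : ℕ) (c d : ℂ) :
    Module.finrank ℂ (matrixIntertwiners (jordanBlock k c) (jordanBlock l d)) =
      if c = d then min k l else 0 := by
  split_ifs with h
  · subst h
    rw [(jordanIntertwinersEquiv k l c).finrank_eq, Module.finrank_fin_fun]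
  · rw [matrixIntertwiners_jordanBlock_of_ne h, finrank_bot]

theorem finrank_commutant_jordanMatrix {K n : ℕ} (lam : Fin K → ℂ) (k : Fin K → ℕ)
    (hn : ∑ i, k i = n) :
    Module.finrank ℂ
        (matrixIntertwiners (jordanMatrix lam k hn) (jordanMatrix lam k hn)) =
      ∑ i, ∑ j, if lam i = lam j then min (k i) (k j) else 0 := by
  rw [jordanMatrix, finrank_matrixIntertwiners_blockDiagonal']
  simp only [finrank_matrixIntertwiners_jordanBlock]


/-! ### Ideals of minors -/

/-- The ideal generated by the minors of order `r` of `M`. Rows and columns are selected by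
arbitrary functions, which adds only `0` and sign changes to the generators. -/
def minorsIdeal {m n R : Type*} [CommRing R] (M : Matrix m n R) (r : ℕ) : Ideal R :=
  Ideal.span (Set.range fun f : (Fin r → m) × (Fin r → n) => (M.submatrix f.1 f.2).det)

section Minors

variable {l m n R : Type*} [CommRing R]

theorem det_submatrix_mem_minorsIdeal (M : Matrix m n R) {r : ℕ} (f : Fin r → m) (g : Fin r → n) :
    (M.submatrix f g).det ∈ minorsIdeal M r :=
  Ideal.subset_span ⟨(f, g), rfl⟩

theorem minorsIdeal_le_iff {M : Matrix m n R} {r : ℕ} {I : Ideal R} :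
    minorsIdeal M r ≤ I ↔ ∀ f g, (M.submatrix f g : Matrix (Fin r) (Fin r) R).det ∈ I := by
  rw [minorsIdeal, Ideal.span_le, Set.range_subset_iff, Prod.forall]
  rfl

theorem minorsIdeal_transpose (M : Matrix m n R) (r : ℕ) :
    minorsIdeal M.transpose r = minorsIdeal M r := by
  apply le_antisymm <;> rw [minorsIdeal_le_iff] <;> intro f g
  · rw [← Matrix.transpose_submatrix, Matrix.det_transpose]
    exact det_submatrix_mem_minorsIdeal M g f
  · rw [← Matrix.det_transpose, Matrix.transpose_submatrix]
    exact det_submatrix_mem_minorsIdeal _ g f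

theorem minorsIdeal_reindex {m' n' : Type*} (e : m ≃ m') (e' : n ≃ n') (M : Matrix m n R) (r : ℕ) :
    minorsIdeal (Matrix.reindex e e' M) r = minorsIdeal M r := by
  apply le_antisymm <;> rw [minorsIdeal_le_iff] <;> intro f g
  · exact det_submatrix_mem_minorsIdeal M (e.symm ∘ f) (e'.symm ∘ g)
  · have h := det_submatrix_mem_minorsIdeal (Matrix.reindex e e' M) (e ∘ f) (e' ∘ g)
    rwa [Matrix.reindex_apply, Matrix.submatrix_submatrix, ← Function.comp_assoc,
      ← Function.comp_assoc, Equiv.symm_comp_self, Equiv.symm_comp_self] at h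

/-- The rows of `P M` are combinations of the rows of `M`, so its minors are combinations of the
minors of `M`. -/
theorem minorsIdeal_mul_le_right [Fintype m] (P : Matrix l m R) (M : Matrix m n R) (r : ℕ) :
    minorsIdeal (P * M) r ≤ minorsIdeal M r := by
  rw [minorsIdeal_le_iff]
  intro f g
  have e : ((P * M).submatrix f g : Matrix (Fin r) (Fin r) R) =
      fun i => ∑ a, P (f i) a • fun j => M a (g j) := by
    ext i j
    simp [Matrix.mul_apply, Finset.sum_apply]
  have h : ((P * M).submatrix f g).det = ∑ φ : Fin r → m,
      (∏ i, P (f i) (φ i)) • (M.submatrix φ g).det := by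
    rw [e]
    change Matrix.detRowAlternating.toMultilinearMap _ = _
    rw [MultilinearMap.map_sum]
    exact Finset.sum_congr rfl fun φ _ => MultilinearMap.map_smul_univ _ _ _
  rw [h]
  exact Ideal.sum_mem _ fun φ _ => Ideal.mul_mem_left _ _ (det_submatrix_mem_minorsIdeal M φ g)

theorem minorsIdeal_mul_le_left [Fintype m] (M : Matrix l m R) (Q : Matrix m n R) (r : ℕ) :
    minorsIdeal (M * Q) r ≤ minorsIdeal M r := by
  rw [← minorsIdeal_transpose, Matrix.transpose_mul, ← minorsIdeal_transpose M]
  exact minorsIdeal_mul_le_right _ _ r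

theorem minorsIdeal_isUnit_mul [Fintype m] [DecidableEq m] {P : Matrix m m R} (hP : IsUnit P)
    (M : Matrix m n R) (r : ℕ) : minorsIdeal (P * M) r = minorsIdeal M r := by
  obtain ⟨u, rfl⟩ := hP
  refine le_antisymm (minorsIdeal_mul_le_right _ _ _) ?_
  have h := minorsIdeal_mul_le_right (↑u⁻¹ : Matrix m m R) ((u : Matrix m m R) * M) r
  rwa [← Matrix.mul_assoc, Units.inv_mul, Matrix.one_mul] at h

theorem minorsIdeal_mul_isUnit [Fintype n] [DecidableEq n] (M : Matrix m n R) {Q : Matrix n n R}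
    (hQ : IsUnit Q) (r : ℕ) : minorsIdeal (M * Q) r = minorsIdeal M r := by
  obtain ⟨u, rfl⟩ := hQ
  refine le_antisymm (minorsIdeal_mul_le_left _ _ _) ?_
  have h := minorsIdeal_mul_le_left (M * (u : Matrix n n R)) (↑u⁻¹ : Matrix n n R) r
  rwa [Matrix.mul_assoc, Units.mul_inv, Matrix.mul_one] at h

theorem minorsIdeal_diagonal [DecidableEq m] (d : m → R) (r : ℕ) :
    minorsIdeal (Matrix.diagonal d) r =
      Ideal.span {p | ∃ S : Finset m, S.card = r ∧ p = ∏ x ∈ S, d x} := by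
  apply le_antisymm
  · rw [minorsIdeal_le_iff]
    intro f g
    by_cases hg : Function.Injective g
    · rw [Matrix.det_apply]
      refine Ideal.sum_mem _ fun σ _ => ?_
      rw [Units.smul_def, zsmul_eq_mul]
      refine Ideal.mul_mem_left _ _ ?_
      by_cases h : ∀ i, f (σ i) = g i
      · refine Ideal.subset_span ⟨Finset.univ.map ⟨g, hg⟩, by simp, ?_⟩
        simp [h]
      · push Not at h
        obtain ⟨i, hi⟩ := h
        rw [Finset.prod_eq_zero (Finset.mem_univ i) (by simp [hi])]
        exact Ideal.zero_mem _
    · rw [Function.Injective] at hg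
      push Not at hg
      obtain ⟨i, j, hij, hne⟩ := hg
      rw [Matrix.det_zero_of_column_eq hne (by simp [hij])]
      exact Ideal.zero_mem _
  · rw [Ideal.span_le]
    rintro _ ⟨S, rfl, rfl⟩
    let f : Fin S.card → m := fun i => (S.equivFin.symm i : m)
    have hf : Function.Injective f := Subtype.val_injective.comp S.equivFin.symm.injective
    have h := det_submatrix_mem_minorsIdeal (Matrix.diagonal d) f f
    rw [Matrix.submatrix_diagonal _ _ hf, Matrix.det_diagonal] at h
    have e : ∏ i, (d ∘ f) i = ∏ x ∈ S, d x := by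
      rw [← Finset.prod_coe_sort S]
      exact S.equivFin.symm.prod_comp fun x : S => d x
    rwa [e] at h

end Minors

/-- Sorting the rows and the columns of a minor changes at most its sign. -/
theorem minorIdeal_eq_minorsIdeal {n : ℕ} (A : Matrix (Fin n) (Fin n) ℂ) (r : ℕ) :
    minorIdeal A r = minorsIdeal A.charmatrix r := by
  apply le_antisymm
  · rw [minorIdeal, Ideal.span_le]
    rintro _ ⟨⟨f, g⟩, rfl⟩
    exact det_submatrix_mem_minorsIdeal _ _ _
  · rw [minorsIdeal_le_iff]
    intro f g
    have factor (f : Fin r → Fin n) (hf : Function.Injective f) :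
        ∃ (f' : Fin r ↪o Fin n) (σ : Equiv.Perm (Fin r)), f = f' ∘ σ := by
      have hmono : StrictMono (f ∘ Tuple.sort f) :=
        (Tuple.monotone_sort f).strictMono_of_injective (hf.comp (Tuple.sort f).injective)
      refine ⟨OrderEmbedding.ofStrictMono _ hmono, (Tuple.sort f)⁻¹, ?_⟩
      ext i
      simp
    by_cases hf : Function.Injective f
    · by_cases hg : Function.Injective g
      · obtain ⟨f', σ, rfl⟩ := factor f hf
        obtain ⟨g', τ, rfl⟩ := factor g hg
        have e : A.charmatrix.submatrix (f' ∘ σ) (g' ∘ τ) =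
            ((A.charmatrix.submatrix f' g').submatrix σ id).submatrix id τ := rfl
        rw [e, Matrix.det_permute', Matrix.det_permute]
        exact Ideal.mul_mem_left _ _ (Ideal.mul_mem_left _ _ (Ideal.subset_span ⟨(f', g'), rfl⟩))
      · rw [Function.Injective] at hg
        push Not at hg
        obtain ⟨i, j, hij, hne⟩ := hg
        rw [Matrix.det_zero_of_column_eq hne (by simp [hij])]
        exact Ideal.zero_mem _
    · rw [Function.Injective] at hf
      push Not at hf
      obtain ⟨i, j, hij, hne⟩ := hf
      rw [Matrix.det_zero_of_row_eq hne (by ext; simp [hij])]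
      exact Ideal.zero_mem _

theorem minorIdeal_eq_of_mem_similarityClass {n : ℕ} {J A : Matrix (Fin n) (Fin n) ℂ}
    (hA : A ∈ similarityClass J) (r : ℕ) : minorIdeal A r = minorIdeal J r := by
  obtain ⟨_, ⟨u, rfl⟩, rfl⟩ := hA
  let φ : Matrix (Fin n) (Fin n) ℂ →+* Matrix (Fin n) (Fin n) ℂ[X] := Polynomial.C.mapMatrix
  have hu : IsUnit (φ u) := u.isUnit.map φ
  have hu' : IsUnit (φ ↑u⁻¹) := u⁻¹.isUnit.map φ
  have h1 : φ ↑u * φ ↑u⁻¹ = 1 := by rw [← map_mul, Units.mul_inv, map_one]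
  have e : ((u : Matrix (Fin n) (Fin n) ℂ) * J * (u : Matrix (Fin n) (Fin n) ℂ)⁻¹).charmatrix =
      φ u * J.charmatrix * φ ↑u⁻¹ := by
    rw [← Matrix.coe_units_inv, Matrix.charmatrix, Matrix.charmatrix]
    change _ - φ _ = φ u * (_ - φ J) * _
    rw [mul_sub, sub_mul, ← map_mul, ← map_mul, ← (Matrix.scalar_commute _ (Commute.all _) _).eq,
      mul_assoc (Matrix.scalar _ _), h1, mul_one]
  rw [minorIdeal_eq_minorsIdeal, minorIdeal_eq_minorsIdeal, e, minorsIdeal_mul_isUnit _ hu',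
    minorsIdeal_isUnit_mul hu]

/-! ### The characteristic matrix of a Jordan matrix -/

/-- The exponents in a diagonal matrix equivalent to `X I - J`: the first position of a block of order
`k` with eigenvalue `c` carries `(X - c) ^ k`, all other positions carry `1`. -/
def jordanExponent {K : ℕ} (k : Fin K → ℕ) (x : Σ i, Fin (k i)) : ℕ :=
  if (x.2 : ℕ) = 0 then k x.1 else 0

/-- With `y = X - c`, the column `(1, y, …, y ^ (m - 1))` is sent by `X I - J` to `y ^ m` times the
last basis vector; hence `X I - J` and `diag (y ^ m, 1, …, 1)` differ by unimodular factors. -/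
theorem exists_smith_jordanBlock (m : ℕ) (c : ℂ) :
    ∃ P Q : Matrix (Fin m) (Fin m) ℂ[X], IsUnit P ∧ IsUnit Q ∧
      (jordanBlock m c).charmatrix * Q = P * Matrix.diagonal fun s : Fin m =>
        (Polynomial.X - Polynomial.C c) ^ (if (s : ℕ) = 0 then m else 0) := by
  set y : ℂ[X] := Polynomial.X - Polynomial.C c with hy
  have hchar (s t : Fin m) : (jordanBlock m c).charmatrix s t =
      (if s = t then y else 0) - if (s : ℕ) + 1 = t then 1 else 0 := by
    by_cases h : s = t
    · subst h
      simp [Matrix.charmatrix, jordanBlock, hy]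
    · by_cases h' : (s : ℕ) + 1 = t <;> simp [Matrix.charmatrix, jordanBlock, h, h']
  let Q : Matrix (Fin m) (Fin m) ℂ[X] :=
    Matrix.of fun s t => if (t : ℕ) = 0 then y ^ (s : ℕ) else if s = t then 1 else 0
  let P : Matrix (Fin m) (Fin m) ℂ[X] :=
    Matrix.of fun s t => if (t : ℕ) = 0 then (if (s : ℕ) + 1 = m then 1 else 0)
      else (jordanBlock m c).charmatrix s t
  let D : Matrix (Fin m) (Fin m) ℂ[X] :=
    Matrix.diagonal fun s : Fin m => y ^ (if (s : ℕ) = 0 then m else 0)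
  have hmul : (jordanBlock m c).charmatrix * Q = P * D := by
    ext1 s t
    rw [Matrix.mul_diagonal, Matrix.mul_apply]
    by_cases ht : (t : ℕ) = 0
    · simp only [Q, P, Matrix.of_apply, ht, if_true, hchar, sub_mul, ite_mul, zero_mul, one_mul,
        Finset.sum_sub_distrib, Finset.sum_ite_eq, Finset.mem_univ, ← pow_succ']
      by_cases hs : (s : ℕ) + 1 = m
      · rw [Finset.sum_eq_zero fun u _ => if_neg (by omega), if_pos hs, hs, sub_zero]
      · rw [Finset.sum_eq_single ⟨s + 1, by omega⟩, if_pos rfl, if_neg hs, sub_self]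
        · intro u _ hu
          exact if_neg fun h => hu (Fin.ext h.symm)
        · simp
    · simp [Q, P, ht]
  have hQ : Q.det = 1 := by
    rw [← Matrix.det_transpose, Matrix.det_of_isUpperTriangular]
    · refine Finset.prod_eq_one fun s _ => ?_
      by_cases hs : (s : ℕ) = 0 <;> simp [Q, hs]
    · intro s t hst
      have hst' : (t : ℕ) < s := hst
      have h0 : (s : ℕ) ≠ 0 := by omega
      have h1 : t ≠ s := fun h => by simp [h] at hst'
      simp [Q, h0, h1]
  have hcharpoly : (jordanBlock m c).charmatrix.det = y ^ m := by
    rw [Matrix.det_of_isUpperTriangular]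
    · simp only [hchar]
      simp
    · intro s t hst
      have hst' : (t : ℕ) < s := hst
      rw [hchar, if_neg (Fin.ne_of_gt hst'), if_neg (by omega), sub_zero]
  have hD : D.det = y ^ m := by
    rw [Matrix.det_diagonal]
    rcases m with _ | m
    · simp
    · rw [Fin.prod_univ_succ]
      simp
  have hP : P.det = 1 := by
    have h := congrArg Matrix.det hmul
    rw [Matrix.det_mul, Matrix.det_mul, hQ, hcharpoly, hD, mul_comm] at h
    exact (mul_right_cancel₀ (pow_ne_zero m (Polynomial.X_sub_C_ne_zero c)) h).symm
  exact ⟨P, Q, (Matrix.isUnit_iff_isUnit_det P).mpr (hP ▸ isUnit_one),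
    (Matrix.isUnit_iff_isUnit_det Q).mpr (hQ ▸ isUnit_one), hmul⟩

theorem charmatrix_blockDiagonal' {ι R : Type*} {m : ι → Type*} [CommRing R] [Fintype ι]
    [DecidableEq ι] [∀ i, Fintype (m i)] [∀ i, DecidableEq (m i)] (B : ∀ i, Matrix (m i) (m i) R) :
    (Matrix.blockDiagonal' B).charmatrix = Matrix.blockDiagonal' fun i => (B i).charmatrix := by
  have h : Matrix.scalar (Σ i, m i) (Polynomial.X : R[X]) =
      Matrix.blockDiagonal' fun i => Matrix.scalar (m i) Polynomial.X := by
    simp only [Matrix.scalar_apply]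
    rw [Matrix.blockDiagonal'_diagonal]
  unfold Matrix.charmatrix
  rw [h]
  simp only [RingHom.mapMatrix_apply]
  rw [Matrix.blockDiagonal'_map _ _ (map_zero _), ← Matrix.blockDiagonal'_sub]
  rfl

theorem isUnit_blockDiagonal' {ι R : Type*} {m : ι → Type*} [CommRing R] [Fintype ι]
    [DecidableEq ι] [∀ i, Fintype (m i)] [∀ i, DecidableEq (m i)] {B : ∀ i, Matrix (m i) (m i) R}
    (hB : ∀ i, IsUnit (B i)) : IsUnit (Matrix.blockDiagonal' B) :=
  (Pi.isUnit_iff.mpr hB).map (Matrix.blockDiagonal'RingHom m R)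

theorem minorIdeal_jordanMatrix {K n : ℕ} (lam : Fin K → ℂ) (k : Fin K → ℕ) (hn : ∑ i, k i = n)
    (r : ℕ) : minorIdeal (jordanMatrix lam k hn) r =
      Ideal.span {p | ∃ S : Finset (Σ i, Fin (k i)), S.card = r ∧
        p = ∏ x ∈ S, (Polynomial.X - Polynomial.C (lam x.1)) ^ jordanExponent k x} := by
  choose P Q hP hQ hPQ using fun i => exists_smith_jordanBlock (k i) (lam i)
  rw [minorIdeal_eq_minorsIdeal, jordanMatrix, Matrix.charmatrix_reindex, minorsIdeal_reindex,
    charmatrix_blockDiagonal', ← minorsIdeal_mul_isUnit _ (isUnit_blockDiagonal' hQ),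
    ← Matrix.blockDiagonal'_mul]
  simp only [hPQ]
  rw [Matrix.blockDiagonal'_mul, minorsIdeal_isUnit_mul (isUnit_blockDiagonal' hP),
    Matrix.blockDiagonal'_diagonal, minorsIdeal_diagonal]
  rfl


/-! ### Sums over decreasing lists -/

theorem Multiset.exists_le_map_eq_of_le_map {α β : Type*} {f : α → β} {s : Multiset α}
    {t : Multiset β} (h : t ≤ s.map f) : ∃ u ≤ s, u.map f = t := by
  induction s using Quotient.inductionOn
  induction t using Quotient.inductionOn
  obtain ⟨_, hperm, hsub⟩ := h
  obtain ⟨u, hu, rfl⟩ := List.sublist_map_iff.mp hsub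
  exact ⟨u, hu.subperm, Multiset.coe_eq_coe.mpr hperm⟩

/-- Among the subfamilies of a decreasing list with at most `m` members, the first `m` entries have
the largest sum. -/
theorem Multiset.sum_le_sum_take {l : List ℕ} (hl : l.Pairwise (· ≥ ·)) {s : Multiset ℕ}
    (hs : s ≤ (l : Multiset ℕ)) {m : ℕ} (hm : s.card ≤ m) : s.sum ≤ (l.take m).sum := by
  induction l generalizing s m with
  | nil =>
    have : s = 0 := by simpa using hs
    simp [this]
  | cons x l ih =>
    rw [List.pairwise_cons] at hl
    rw [← Multiset.cons_coe] at hs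
    rcases s.empty_or_exists_mem with rfl | ⟨y, hy⟩
    · simp
    obtain ⟨m, rfl⟩ : ∃ m', m = m' + 1 :=
      ⟨m - 1, by have := Multiset.card_pos_iff_exists_mem.mpr ⟨y, hy⟩; omega⟩
    rw [List.take_succ_cons, List.sum_cons]
    by_cases hx : x ∈ s
    · obtain ⟨s, rfl⟩ := Multiset.exists_cons_of_mem hx
      rw [Multiset.cons_le_cons_iff] at hs
      rw [Multiset.card_cons] at hm
      rw [Multiset.sum_cons]
      exact Nat.add_le_add_left (ih hl.2 hs (by omega)) x
    · rw [Multiset.le_cons_of_notMem hx] at hs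
      have hyx : y ≤ x := hl.1 y (Multiset.mem_coe.mp (Multiset.mem_of_le hs hy))
      obtain ⟨s, rfl⟩ := Multiset.exists_cons_of_mem hy
      rw [Multiset.card_cons] at hm
      rw [Multiset.sum_cons]
      exact Nat.add_le_add hyx (ih hl.2 ((Multiset.le_cons_self s y).trans hs) (by omega))

theorem List.sum_range_getD (l : List ℕ) {M : ℕ} (hM : l.length ≤ M) :
    ∑ j ∈ Finset.range M, l.getD j 0 = l.sum := by
  induction l generalizing M with
  | nil => simp
  | cons x l ih =>
    rw [List.length_cons] at hM
    obtain ⟨M, rfl⟩ : ∃ M', M = M' + 1 := ⟨M - 1, by omega⟩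
    rw [Finset.sum_range_succ', List.sum_cons, add_comm]
    simp only [List.getD_cons_zero, List.getD_cons_succ]
    rw [ih (by omega)]

theorem List.sum_drop_eq_getD_add (l : List ℕ) (j : ℕ) :
    (l.drop j).sum = l.getD j 0 + (l.drop (j + 1)).sum := by
  induction l generalizing j with
  | nil => simp
  | cons x l ih =>
    cases j with
    | zero => simp
    | succ j => simpa using ih j

/-- In a decreasing list, the minimum of a pair of entries is the one with the larger index, and
`j` is the larger index of `2 j + 1` ordered pairs. -/
theorem List.sum_sum_min {l : List ℕ} (hl : l.Pairwise (· ≥ ·)) {M : ℕ} (hM : l.length ≤ M) :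
    (l.map fun x => (l.map fun y => min x y).sum).sum =
      ∑ j ∈ Finset.range M, (2 * j + 1) * l.getD j 0 := by
  induction l generalizing M with
  | nil => simp
  | cons x l ih =>
    rw [List.pairwise_cons] at hl
    have h1 : (l.map fun y => min x y) = l := by
      conv_rhs => rw [← List.map_id l]
      exact List.map_congr_left fun y hy => min_eq_right (hl.1 y hy)
    have h2 : (l.map fun y => min y x) = l := by
      conv_rhs => rw [← List.map_id l]
      exact List.map_congr_left fun y hy => min_eq_left (hl.1 y hy)
    rw [List.length_cons] at hM
    obtain ⟨M, rfl⟩ : ∃ M', M = M' + 1 := ⟨M - 1, by omega⟩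
    have hM' : l.length ≤ M := by omega
    rw [Finset.sum_range_succ']
    simp only [List.map_cons, List.sum_cons, List.getD_cons_zero, List.getD_cons_succ, min_self,
      List.sum_map_add, h1, h2, ih hl.2 hM']
    have h3 : ∑ j ∈ Finset.range M, (2 * (j + 1) + 1) * l.getD j 0 =
        ∑ j ∈ Finset.range M, (2 * j + 1) * l.getD j 0 + 2 * l.sum := by
      rw [← List.sum_range_getD l hM', Finset.mul_sum, ← Finset.sum_add_distrib]
      exact Finset.sum_congr rfl fun j _ => by ring
    rw [h3]
    ring

theorem Finset.sum_Icc_one_eq_sum_range {M : Type*} [AddCommMonoid M] (f : ℕ → M) (N : ℕ) :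
    ∑ j ∈ Finset.Icc 1 N, f j = ∑ j ∈ Finset.range N, f (j + 1) := by
  rw [Finset.range_eq_Ico, Finset.sum_Ico_add' f 0 N 1]
  rfl

section BlockOrders

variable {K : ℕ} (lam : Fin K → ℂ) (k : Fin K → ℕ) (a : ℂ)

theorem coe_blockOrders :
    (blockOrders lam k a : Multiset ℕ) = (Finset.univ.filter fun i => lam i = a).val.map k :=
  Multiset.sort_eq _ _

theorem pairwise_blockOrders : (blockOrders lam k a).Pairwise (· ≥ ·) :=
  Multiset.pairwise_sort _ _

theorem length_blockOrders : (blockOrders lam k a).length = numBlocks lam a := by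
  rw [← Multiset.coe_card, coe_blockOrders, Multiset.card_map]
  rfl

theorem sum_map_blockOrders (f : ℕ → ℕ) :
    ((blockOrders lam k a).map f).sum = ∑ i with lam i = a, f (k i) := by
  rw [← Multiset.sum_coe, ← Multiset.map_coe, coe_blockOrders, Multiset.map_map]
  rfl

theorem sum_blockOrders : (blockOrders lam k a).sum = ∑ i with lam i = a, k i := by
  have h := sum_map_blockOrders lam k a id
  rwa [List.map_id] at h

theorem sum_le_sum_take_blockOrders {T : Finset (Fin K)} (hT : ∀ i ∈ T, lam i = a) {m : ℕ}
    (hm : T.card ≤ m) : ∑ i ∈ T, k i ≤ ((blockOrders lam k a).take m).sum := by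
  refine Multiset.sum_le_sum_take (pairwise_blockOrders lam k a) (s := T.val.map k) ?_
    (by rwa [Multiset.card_map])
  rw [coe_blockOrders]
  exact Multiset.map_le_map (Finset.val_le_iff.mpr fun i hi => by simp [hT i hi])

theorem exists_sum_eq_sum_take_blockOrders (m : ℕ) :
    ∃ T : Finset (Fin K), (∀ i ∈ T, lam i = a) ∧ T.card ≤ m ∧
      ∑ i ∈ T, k i = ((blockOrders lam k a).take m).sum := by
  have hle : ((blockOrders lam k a).take m : Multiset ℕ) ≤
      (Finset.univ.filter fun i => lam i = a).val.map k := by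
    rw [← coe_blockOrders]
    exact (List.take_sublist m _).subperm
  obtain ⟨u, hu, hu'⟩ := Multiset.exists_le_map_eq_of_le_map hle
  refine ⟨⟨u, Multiset.nodup_of_le hu (Finset.nodup _)⟩, fun i hi => ?_, ?_, ?_⟩
  · exact (Finset.mem_filter.mp (Multiset.mem_of_le hu hi)).2
  · have h := congrArg Multiset.card hu'
    rw [Multiset.card_map, Multiset.coe_card, List.length_take] at h
    change u.card ≤ m
    omega
  · change (u.map k).sum = _
    rw [hu', Multiset.sum_coe]

theorem sum_sum_min_eq_sum_blockOrder :
    ∑ i, ∑ j, (if lam i = lam j then min (k i) (k j) else 0) =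
      ∑ j ∈ Finset.Icc 1 (maxNumBlocks lam),
        (2 * j - 1) * ∑ a ∈ distinctEigenvalues lam, blockOrder lam k a j := by
  have h1 (a : ℂ) (ha : a ∈ distinctEigenvalues lam) :
      (∑ i with lam i = a, ∑ j, if lam i = lam j then min (k i) (k j) else 0) =
        ∑ j ∈ Finset.range (maxNumBlocks lam), (2 * j + 1) * (blockOrders lam k a).getD j 0 := by
    have hlen : (blockOrders lam k a).length ≤ maxNumBlocks lam :=
      (length_blockOrders lam k a).trans_le (Finset.le_sup (f := numBlocks lam) ha)
    rw [← List.sum_sum_min (pairwise_blockOrders lam k a) hlen,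
      sum_map_blockOrders lam k a fun x => ((blockOrders lam k a).map fun y => min x y).sum]
    refine Finset.sum_congr rfl fun i hi => ?_
    rw [sum_map_blockOrders, Finset.sum_filter]
    simp only [(Finset.mem_filter.mp hi).2, eq_comm]
  rw [← Finset.sum_fiberwise_of_maps_to (s := Finset.univ) (t := distinctEigenvalues lam) (g := lam)
    fun i _ => Finset.mem_image_of_mem lam (Finset.mem_univ i), Finset.sum_congr rfl h1,
    Finset.sum_comm, Finset.sum_Icc_one_eq_sum_range]
  refine Finset.sum_congr rfl fun j _ => ?_
  rw [Finset.mul_sum]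
  rfl

end BlockOrders

/-! ### Degrees of the determinantal divisors -/

theorem rootMultiplicity_prod_X_sub_C_pow {σ : Type*} (S : Finset σ) (c : σ → ℂ) (e : σ → ℕ)
    (a : ℂ) :
    (∏ x ∈ S, (Polynomial.X - Polynomial.C (c x)) ^ e x).rootMultiplicity a =
      ∑ x ∈ S with c x = a, e x := by
  have h0 (x : σ) : (Polynomial.X - Polynomial.C (c x)) ^ e x ≠ 0 :=
    pow_ne_zero _ (Polynomial.X_sub_C_ne_zero _)
  rw [← Polynomial.count_roots, Polynomial.roots_prod _ _ (Finset.prod_ne_zero_iff.mpr fun x _ => h0 x),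
    Multiset.count_bind, Finset.sum_filter]
  refine congrArg Multiset.sum (Multiset.map_congr rfl fun x _ => ?_)
  rw [Polynomial.roots_pow, Polynomial.roots_X_sub_C, Multiset.count_nsmul,
    Multiset.count_singleton]
  simp [eq_comm]

/-- The multiplicity of a root of the greatest common divisor of products of linear factors is the
smallest multiplicity among these products. -/
theorem natDegree_generator_span_prod {σ : Type*} {c : σ → ℂ} {e : σ → ℕ}
    {r : ℕ} {μ : ℂ → ℕ} {E : Finset ℂ} (hE : ∀ x, c x ∈ E)
    (hle : ∀ a (S : Finset σ), S.card = r → μ a ≤ ∑ x ∈ S with c x = a, e x)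
    (hex : ∀ a, ∃ S : Finset σ, S.card = r ∧ ∑ x ∈ S with c x = a, e x ≤ μ a) {I : Ideal ℂ[X]}
    (hI : I = Ideal.span {p | ∃ S : Finset σ, S.card = r ∧
      p = ∏ x ∈ S, (Polynomial.X - Polynomial.C (c x)) ^ e x}) :
    Submodule.IsPrincipal.generator I ≠ 0 ∧
      (Submodule.IsPrincipal.generator I).natDegree = ∑ a ∈ E, μ a := by
  set g := Submodule.IsPrincipal.generator I with hg
  have hdvd (S : Finset σ) (hS : S.card = r) :
      g ∣ ∏ x ∈ S, (Polynomial.X - Polynomial.C (c x)) ^ e x := by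
    rw [hg, ← Submodule.IsPrincipal.mem_iff_generator_dvd, hI]
    exact Ideal.subset_span ⟨S, hS, rfl⟩
  have h0 (S : Finset σ) : ∏ x ∈ S, (Polynomial.X - Polynomial.C (c x)) ^ e x ≠ 0 :=
    Finset.prod_ne_zero_iff.mpr fun x _ => pow_ne_zero _ (Polynomial.X_sub_C_ne_zero _)
  have hg0 : g ≠ 0 := by
    obtain ⟨S, hS, -⟩ := hex 0
    exact ne_zero_of_dvd_ne_zero (h0 S) (hdvd S hS)
  have hmult (a : ℂ) : g.rootMultiplicity a = μ a := by
    apply le_antisymm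
    · obtain ⟨S, hS, hμ⟩ := hex a
      refine le_trans ?_ hμ
      rw [← rootMultiplicity_prod_X_sub_C_pow]
      exact Polynomial.rootMultiplicity_le_rootMultiplicity_of_dvd (h0 S) (hdvd S hS) a
    · rw [Polynomial.le_rootMultiplicity_iff hg0, ← Ideal.mem_span_singleton]
      have hsub : I ≤ Ideal.span {(Polynomial.X - Polynomial.C a) ^ μ a} := by
        rw [hI, Ideal.span_le]
        rintro _ ⟨S, hS, rfl⟩
        rw [SetLike.mem_coe, Ideal.mem_span_singleton, ← Polynomial.le_rootMultiplicity_iff (h0 S),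
          rootMultiplicity_prod_X_sub_C_pow]
        exact hle a S hS
      exact hsub (Submodule.IsPrincipal.generator_mem I)
  refine ⟨hg0, ?_⟩
  rw [← Polynomial.splits_iff_card_roots.mp (IsAlgClosed.splits g),
    ← Multiset.sum_count_eq_card (s := E)]
  · simp only [Polynomial.count_roots, hmult]
  · intro a ha
    have hpos : 0 < μ a := by
      rw [← hmult]
      exact (Polynomial.rootMultiplicity_pos hg0).mpr ((Polynomial.mem_roots hg0).mp ha)
    obtain ⟨S, hS, -⟩ := hex a
    have h := hle a S hS
    obtain ⟨x, hx, -⟩ := Finset.exists_ne_zero_of_sum_ne_zero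
      (s := S.filter fun x => c x = a) (f := e) (by omega)
    exact (Finset.mem_filter.mp hx).2 ▸ hE x

section DeterminantalDivisor

variable {K n : ℕ} (lam : Fin K → ℂ) (k : Fin K → ℕ)

theorem sum_jordanExponent (a : ℂ) :
    ∑ x : (Σ i, Fin (k i)) with lam x.1 = a, jordanExponent k x = (blockOrders lam k a).sum := by
  rw [sum_blockOrders, Finset.sum_filter, Finset.sum_filter, Fintype.sum_sigma]
  refine Finset.sum_congr rfl fun i _ => ?_
  split_ifs with h
  · simp only [jordanExponent]
    rcases hki : k i with _ | m
    · simp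
    · rw [Fin.sum_univ_succ]
      simp
  · simp

/-- The part of the exponent of `X - a` carried by a set `U` of indices is a sum of at most `|U|`
orders of blocks. -/
theorem sum_jordanExponent_le (a : ℂ) (U : Finset (Σ i, Fin (k i))) :
    ∑ x ∈ U with lam x.1 = a, jordanExponent k x ≤
      ((blockOrders lam k a).take U.card).sum := by
  have hinj : Set.InjOn Sigma.fst
      ((U.filter fun x => lam x.1 = a).filter fun x => (x.2 : ℕ) = 0 : Set (Σ i, Fin (k i))) := by
    rintro ⟨i, s⟩ hs ⟨j, t⟩ ht h
    obtain rfl : i = j := h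
    have hs' : (s : ℕ) = 0 := (Finset.mem_filter.mp hs).2
    have ht' : (t : ℕ) = 0 := (Finset.mem_filter.mp ht).2
    rw [Fin.ext (hs'.trans ht'.symm)]
  have e : ∑ x ∈ U with lam x.1 = a, jordanExponent k x =
      ∑ i ∈ ((U.filter fun x => lam x.1 = a).filter fun x => (x.2 : ℕ) = 0).image Sigma.fst,
        k i := by
    rw [Finset.sum_image hinj]
    exact (Finset.sum_filter (fun x : Σ i, Fin (k i) => (x.2 : ℕ) = 0) fun x => k x.1).symm
  rw [e]
  apply sum_le_sum_take_blockOrders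
  · intro i hi
    obtain ⟨x, hx, rfl⟩ := Finset.mem_image.mp hi
    exact (Finset.mem_filter.mp (Finset.mem_filter.mp hx).1).2
  · exact Finset.card_image_le.trans
      ((Finset.card_filter_le _ _).trans (Finset.card_filter_le _ _))

theorem exists_le_sum_jordanExponent (hk : ∀ i, 0 < k i) (a : ℂ) {m : ℕ}
    (hm : m ≤ Fintype.card (Σ i, Fin (k i))) :
    ∃ U : Finset (Σ i, Fin (k i)), U.card = m ∧
      ((blockOrders lam k a).take m).sum ≤ ∑ x ∈ U with lam x.1 = a, jordanExponent k x := by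
  obtain ⟨T, hTa, hTm, hT⟩ := exists_sum_eq_sum_take_blockOrders lam k a m
  let z : Fin K ↪ Σ i, Fin (k i) := ⟨fun i => ⟨i, ⟨0, hk i⟩⟩, fun i j h => congrArg Sigma.fst h⟩
  obtain ⟨U, hTU, hU⟩ := Finset.exists_superset_card_eq (s := T.map z) (n := m)
    (by rwa [Finset.card_map]) hm
  refine ⟨U, hU, ?_⟩
  rw [← hT]
  calc ∑ i ∈ T, k i = ∑ x ∈ T.map z, jordanExponent k x := by
        rw [Finset.sum_map]
        rfl
    _ ≤ _ := by
        refine Finset.sum_le_sum_of_subset fun x hx => Finset.mem_filter.mpr ⟨hTU hx, ?_⟩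
        obtain ⟨i, hi, rfl⟩ := Finset.mem_map.mp hx
        exact hTa i hi

/-- The multiplicity of `X - a` in `D_r` is the sum of the orders of the blocks with eigenvalue `a`
other than the `n - r` largest ones: leaving out `n - r` of the diagonal entries `(X - c) ^ k` or `1` removes at
most that many powers of `X - a`. -/
theorem natDegree_generator_minorIdeal_jordanMatrix (hk : ∀ i, 0 < k i) (hn : ∑ i, k i = n) {r : ℕ}
    (hr : r ≤ n) :
    Submodule.IsPrincipal.generator (minorIdeal (jordanMatrix lam k hn) r) ≠ 0 ∧
      (Submodule.IsPrincipal.generator (minorIdeal (jordanMatrix lam k hn) r)).natDegree =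
        ∑ a ∈ distinctEigenvalues lam, ((blockOrders lam k a).drop (n - r)).sum := by
  have hcard : Fintype.card (Σ i, Fin (k i)) = n := by simp [hn]
  have hsplit (a : ℂ) (S : Finset (Σ i, Fin (k i))) :
      ∑ x ∈ S with lam x.1 = a, jordanExponent k x +
        ∑ x ∈ Sᶜ with lam x.1 = a, jordanExponent k x =
      ((blockOrders lam k a).take (n - r)).sum + ((blockOrders lam k a).drop (n - r)).sum := by
    rw [List.sum_take_add_sum_drop, ← sum_jordanExponent, Finset.sum_filter, Finset.sum_filter,
      Finset.sum_filter, Finset.sum_add_sum_compl]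
  refine natDegree_generator_span_prod (c := fun x : Σ i, Fin (k i) => lam x.1)
    (e := jordanExponent k) (μ := fun a => ((blockOrders lam k a).drop (n - r)).sum)
    (fun x => Finset.mem_image_of_mem lam (Finset.mem_univ _)) (fun a S hS => ?_) (fun a => ?_)
    (minorIdeal_jordanMatrix lam k hn r)
  · have h1 := sum_jordanExponent_le lam k a Sᶜ
    rw [Finset.card_compl, hS, hcard] at h1
    have h2 := hsplit a S
    omega
  · obtain ⟨U, hU, h1⟩ := exists_le_sum_jordanExponent lam k hk a (m := n - r) (by omega)
    refine ⟨Uᶜ, by rw [Finset.card_compl, hU, hcard]; omega, ?_⟩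
    have h2 := hsplit a Uᶜ
    rw [compl_compl] at h2
    omega

theorem natDegree_determinantalDivisor (hk : ∀ i, 0 < k i) (hn : ∑ i, k i = n)
    {A : Matrix (Fin n) (Fin n) ℂ} (hA : A ∈ similarityClass (jordanMatrix lam k hn)) {r : ℕ}
    (hr : r ≤ n) :
    determinantalDivisor A r ≠ 0 ∧ (determinantalDivisor A r).natDegree =
      ∑ a ∈ distinctEigenvalues lam, ((blockOrders lam k a).drop (n - r)).sum := by
  obtain ⟨h1, h2⟩ := natDegree_generator_minorIdeal_jordanMatrix lam k hk hn hr
  have e : determinantalDivisor A r = normalize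
      (Submodule.IsPrincipal.generator (minorIdeal (jordanMatrix lam k hn) r)) := by
    simp only [determinantalDivisor, minorIdeal_eq_of_mem_similarityClass hA]
  rw [e]
  refine ⟨fun h => h1 (normalize_eq_zero.mp h), ?_⟩
  rw [← h2]
  exact Polynomial.natDegree_eq_of_degree_eq Polynomial.degree_normalize

theorem natDegree_div_of_le {p q : ℂ[X]} (hp : p ≠ 0) (hq : q ≠ 0)
    (h : q.natDegree ≤ p.natDegree) : (p / q).natDegree = p.natDegree - q.natDegree := by
  have hdeg := Polynomial.degree_add_div hq (p := p) (by
    rw [Polynomial.degree_eq_natDegree hp, Polynomial.degree_eq_natDegree hq]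
    exact_mod_cast h)
  have hpq : p / q ≠ 0 := by
    intro h0
    rw [h0, Polynomial.degree_zero, WithBot.add_bot, eq_comm, Polynomial.degree_eq_bot] at hdeg
    exact hp hdeg
  rw [Polynomial.degree_eq_natDegree hp, Polynomial.degree_eq_natDegree hq,
    Polynomial.degree_eq_natDegree hpq] at hdeg
  have h' : q.natDegree + (p / q).natDegree = p.natDegree := by exact_mod_cast hdeg
  omega

theorem natDegree_invariantPolynomial (hk : ∀ i, 0 < k i) (hn : ∑ i, k i = n)
    {A : Matrix (Fin n) (Fin n) ℂ} (hA : A ∈ similarityClass (jordanMatrix lam k hn)) {j : ℕ}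
    (hj : 1 ≤ j) : (invariantPolynomial A j).natDegree =
      ∑ a ∈ distinctEigenvalues lam, blockOrder lam k a j := by
  by_cases hjn : j ≤ n
  · obtain ⟨hp, hp'⟩ := natDegree_determinantalDivisor lam k hk hn hA (r := n + 1 - j) (by omega)
    obtain ⟨hq, hq'⟩ := natDegree_determinantalDivisor lam k hk hn hA (r := n - j) (by omega)
    rw [show n - (n + 1 - j) = j - 1 by omega] at hp'
    rw [show n - (n - j) = j - 1 + 1 by omega] at hq'
    simp only [List.sum_drop_eq_getD_add _ (j - 1), Finset.sum_add_distrib, ← hq'] at hp'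
    rw [invariantPolynomial, natDegree_div_of_le hp hq (by omega), hp', Nat.add_sub_cancel]
    rfl
  · have e1 : n + 1 - j = 0 := by omega
    have e2 : n - j = 0 := by omega
    obtain ⟨hp, -⟩ := natDegree_determinantalDivisor lam k hk hn hA (r := 0) (by omega)
    rw [invariantPolynomial, e1, e2, EuclideanDomain.div_self hp, Polynomial.natDegree_one]
    refine (Finset.sum_eq_zero fun a _ => List.getD_eq_default _ _ ?_).symm
    have hK : K ≤ n := by
      rw [← hn]
      simpa using Finset.card_nsmul_le_sum Finset.univ k 1 fun i _ => hk i
    have h : numBlocks lam a ≤ K := (Finset.card_filter_le _ _).trans_eq (Finset.card_fin K)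
    rw [length_blockOrders]
    omega

end DeterminantalDivisor

/-! ### The dimension formula -/

section Dimension

attribute [local instance] Matrix.linftyOpNormedRing Matrix.linftyOpNormedAlgebra

theorem finrank_range_intertwine_add_commutant {n : ℕ} (J : Matrix (Fin n) (Fin n) ℂ) :
    Module.finrank ℂ (LinearMap.range (intertwine J J)) +
      Module.finrank ℂ (matrixIntertwiners J J) = n ^ 2 := by
  have hker : LinearMap.ker (intertwine J J) = matrixIntertwiners J J := by
    ext X
    exact sub_eq_zero
  have h := (intertwine J J).finrank_range_add_finrank_ker
  rw [hker, Module.finrank_matrix] at h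
  simpa [sq] using h

/-- The similarity class of `J` is a complex submanifold whose codimension is the dimension of the
centralizer of `J`. -/
theorem exists_hasComplexDim_add_commutant {n : ℕ} (J : Matrix (Fin n) (Fin n) ℂ) :
    ∃ d, HasComplexDim (similarityClass J) d ∧
      d + Module.finrank ℂ (matrixIntertwiners J J) = n ^ 2 :=
  ⟨_, hasComplexDim_similarityClass J, finrank_range_intertwine_add_commutant J⟩

end Dimension

theorem theorem6 {K n : ℕ} (lam : Fin K → ℂ) (k : Fin K → ℕ) (hk : ∀ i, 0 < k i)
    (hn : ∑ i, k i = n) :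
    (∃ d : ℕ, HasComplexDim (similarityClass (jordanMatrix lam k hn)) d ∧
      (d : ℤ) = (n : ℤ) ^ 2 - ∑ j ∈ Finset.Icc 1 (maxNumBlocks lam),
        (2 * (j : ℤ) - 1) * ∑ a ∈ distinctEigenvalues lam, (blockOrder lam k a j : ℤ) ∧
      (d : ℤ) = (n : ℤ) ^ 2 - ∑ j ∈ Finset.Icc 1 (maxNumBlocks lam),
        (2 * (j : ℤ) - 1) * ((invariantPolynomial (jordanMatrix lam k hn) j).natDegree : ℤ)) ∧
    ∀ A ∈ similarityClass (jordanMatrix lam k hn), ∀ j : ℕ, 1 ≤ j →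
      (invariantPolynomial A j).natDegree = ∑ a ∈ distinctEigenvalues lam, blockOrder lam k a j := by
  have hinv : ∀ A ∈ similarityClass (jordanMatrix lam k hn), ∀ j : ℕ, 1 ≤ j →
      (invariantPolynomial A j).natDegree =
        ∑ a ∈ distinctEigenvalues lam, blockOrder lam k a j :=
    fun A hA j hj => natDegree_invariantPolynomial lam k hk hn hA hj
  obtain ⟨d, hdim, hrank⟩ := exists_hasComplexDim_add_commutant (jordanMatrix lam k hn)
  rw [finrank_commutant_jordanMatrix, sum_sum_min_eq_sum_blockOrder] at hrank
  have hd : (d : ℤ) = (n : ℤ) ^ 2 - ∑ j ∈ Finset.Icc 1 (maxNumBlocks lam),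
      (2 * (j : ℤ) - 1) * ∑ a ∈ distinctEigenvalues lam, (blockOrder lam k a j : ℤ) := by
    rw [eq_sub_iff_add_eq, ← Nat.cast_pow, ← hrank, Nat.cast_add, Nat.cast_sum]
    congr 1
    refine Finset.sum_congr rfl fun j hj => ?_
    have hj1 : 1 ≤ 2 * j := by have := (Finset.mem_Icc.mp hj).1; omega
    rw [Nat.cast_mul, Nat.cast_sub hj1, Nat.cast_sum]
    push_cast
    rfl
  refine ⟨⟨d, hdim, hd, ?_⟩, hinv⟩
  have hJ : jordanMatrix lam k hn ∈ similarityClass (jordanMatrix lam k hn) :=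
    ⟨1, isUnit_one, by simp⟩
  rw [hd]
  congr 1
  refine Finset.sum_congr rfl fun j hj => ?_
  rw [hinv _ hJ j (Finset.mem_Icc.mp hj).1, Nat.cast_sum]
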